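/- Let $\mathcal A$ and $\mathcal B$ be Grothendieck categories, and let $\Gamma=(F,G,\eta,\rho)$ be a right wide Morita context between them: $F:\mathcal B\to\mathcal A$ and $G:\mathcal A\to\mathcal B$ are additive right exact functors, and $\eta:F\circ G\to 1_{\mathcal A}$ and $\rho:G\circ F\to 1_{\mathcal B}$ are natural transformations such that $G\eta=\rho G$ and $F\rho=\eta F$. Assume that $F$ and $G$ have right adjoints $F':\mathcal A\to\mathcal B$ and $G':\mathcal B\to\mathcal A$. Put $$\mathcal C_\Gamma=\{X\in\mathcal A \mid f\circ\eta(M)=0 \text{ for all } M\in\mathcal A \text{ and all } f:M\to X\},$$ $$\mathcal D_\Gamma=\{Y\in\mathcal B \mid f\circ\rho(N)=0 \text{ for all } N\in\mathcal B \text{ and all } f:N\to Y\}.$$ A full subcategory is localizing if it is closed under subobjects, factor objects, extensions and arbitrary direct sums. Let $\overline{\mathcal C_\Gamma}$ and $\overline{\mathcal D_\Gamma}$ be the smallest localizing subcategories of $\mathcal A$ and $\mathcal B$ that contain $\mathcal C_\Gamma$ and $\mathcal D_\Gamma$, respectively. Let $Q_{\mathcal A}:\mathcal A\to\mathcal A/\overline{\mathcal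 C_\Gamma}$ and $Q_{\mathcal B}:\mathcal B\to\mathcal B/\overline{\mathcal D_\Gamma}$ be the canonical functors to the quotient categories, which are obtained by inverting the morphisms whose kernel and cokernel lie in the given localizing subcategory. Then the quotient categories $\mathcal A/\overline{\mathcal C_\Gamma}$ and $\mathcal B/\overline{\mathcal D_\Gamma}$ are equivalent via $F'$ and $G'$: there are mutually quasi-inverse equivalences $$E:\mathcal A/\overline{\mathcal C_\Gamma}\to\mathcal B/\overline{\mathcal D_\Gamma},\qquad E':\mathcal B/\overline{\mathcal D_\Gamma}\to\mathcal A/\overline{\mathcal C_\Gamma}$$ with natural isomorphisms $E\circ Q_{\mathcal A}\cong Q_{\mathcal B}\circ F'$ and $E'\circ Q_{\mathcal B}\cong Q_{\mathcal A}\circ G'$. Moreover $F'$ maps $\overline{\mathcal C_\Gamma}$-closed objects to $\overline{\mathcal D_\Gamma}$-closed objects, and $G'$ maps $\overline{\mathcal D_\Gamma}$-closed objects to $\overline{\mathcal C_\Gamma}$-closed objects. Here, for a localizing subcategory $\mathcal C$, an object $M$ is called $\mathcal C$-closed if it has no non-zero subobject in $\mathcal C$ and if, for every monomorphism $X'\to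 X$ with $X/X'\in\mathcal C$, every morphism $X'\to M$ extends to $X$. -/

import Mathlib

open CategoryTheory CategoryTheory.Limits

universe w v₁ v₂ u₁ u₂

/-- A right wide Morita context `(F, G, η, ρ)` between the abelian categories `A` and `B`:
additive right exact functors `F : B ⥤ A` and `G : A ⥤ B`, and natural transformations
`η : F ∘ G ⟶ 1_A` and `ρ : G ∘ F ⟶ 1_B` such that `Gη = ρG` and `Fρ = ηF`.
(In Mathlib `G ⋙ F` is the composite `F ∘ G`, first `G`, then `F`.) -/
structure RightWideMoritaContext (A : Type u₁) [Category.{v₁} A] [Abelian A]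
    (B : Type u₂) [Category.{v₂} B] [Abelian B] where
  F : B ⥤ A
  G : A ⥤ B
  additive_F : F.Additive
  additive_G : G.Additive
  rightExact_F : PreservesFiniteColimits F
  rightExact_G : PreservesFiniteColimits G
  η : G ⋙ F ⟶ 𝟭 A
  ρ : F ⋙ G ⟶ 𝟭 B
  map_η : ∀ X : A, G.map (η.app X) = ρ.app (G.obj X)
  map_ρ : ∀ Y : B, F.map (ρ.app Y) = η.app (F.obj Y)

namespace RightWideMoritaContext

variable {A : Type u₁} [Category.{v₁} A] [Abelian A]
  {B : Type u₂} [Category.{v₂} B] [Abelian B]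

/-- The class `C_Γ` of the objects `X` of `A` such that `f ∘ η(M) = 0` for all `M` and all
`f : M ⟶ X`. -/
def classC (Γ : RightWideMoritaContext A B) : ObjectProperty A :=
  fun X => ∀ (M : A) (f : M ⟶ X), Γ.η.app M ≫ f = 0

/-- The class `D_Γ` of the objects `Y` of `B` such that `f ∘ ρ(N) = 0` for all `N` and all
`f : N ⟶ Y`. -/
def classD (Γ : RightWideMoritaContext A B) : ObjectProperty B :=
  fun Y => ∀ (N : B) (f : N ⟶ Y), Γ.ρ.app N ≫ f = 0

end RightWideMoritaContext

section Localizing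

variable {A : Type u₁} [Category.{v₁} A] [Abelian A]

/-- A localizing subcategory: a full subcategory (given by its class of objects) that is closed
under subobjects, factor objects, extensions and arbitrary (`w`-small) direct sums.  The first
three closure conditions, with the zero object, form Mathlib's notion of a Serre class. -/
class IsLocalizingSubcategory (P : ObjectProperty A) : Prop extends P.IsSerreClass where
  closedUnderDirectSums : ∀ J : Type w, P.IsClosedUnderColimitsOfShape (Discrete J)

/-- The smallest localizing subcategory containing `P`: the intersection of all localizing
subcategories that contain `P`. -/
def localizingClosure (P : ObjectProperty A) : ObjectProperty A :=
  fun X => ∀ Q : ObjectProperty A, IsLocalizingSubcategory.{w} Q → P ≤ Q → Q X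

theorem le_localizingClosure (P : ObjectProperty A) : P ≤ localizingClosure.{w} P :=
  fun X hX _ _ hPQ => hPQ X hX

theorem localizingClosure_le (P Q : ObjectProperty A) (hQ : IsLocalizingSubcategory.{w} Q)
    (hPQ : P ≤ Q) : localizingClosure.{w} P ≤ Q :=
  fun _ hX => hX Q hQ hPQ

instance isLocalizingSubcategory_localizingClosure (P : ObjectProperty A) :
    IsLocalizingSubcategory.{w} (localizingClosure.{w} P) where
  exists_zero := by
    open ZeroObject in
    exact ⟨0, isZero_zero A, fun Q hQ _ => Q.prop_zero⟩
  prop_of_mono f _ hY := fun Q hQ hPQ => Q.prop_of_mono f (hY Q hQ hPQ)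
  prop_of_epi f _ hX := fun Q hQ hPQ => Q.prop_of_epi f (hX Q hQ hPQ)
  prop_X₂_of_shortExact hS h₁ h₃ :=
    fun Q hQ hPQ => Q.prop_X₂_of_shortExact hS (h₁ Q hQ hPQ) (h₃ Q hQ hPQ)
  closedUnderDirectSums J :=
    { colimitsOfShape_le := fun X hX Q hQ hPQ => by
        have := hQ.closedUnderDirectSums J
        obtain ⟨p⟩ := hX
        exact Q.prop_of_isColimit p.isColimit fun j => p.prop_diag_obj j Q hQ hPQ }

instance isSerreClass_localizingClosure (P : ObjectProperty A) :
    (localizingClosure.{w} P).IsSerreClass :=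
  (isLocalizingSubcategory_localizingClosure.{w} P).toIsSerreClass

/-- The quotient category `A/P` of `A` by a Serre class `P` (in particular by a localizing
subcategory): the localization of `A` with respect to the morphisms whose kernel and cokernel
belong to `P`. -/
abbrev QuotientCategory (P : ObjectProperty A) [P.IsSerreClass] :=
  P.isoModSerre.Localization

/-- The canonical functor `A ⥤ A/P`. -/
abbrev quotientFunctor (P : ObjectProperty A) [P.IsSerreClass] : A ⥤ QuotientCategory P :=
  P.isoModSerre.Q

/-- `M` is `P`-torsion free: every subobject of `M` that belongs to `P` is zero. -/
def IsTorsionFreeObject (P : ObjectProperty A) (M : A) : Prop :=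
  ∀ (X : A) (i : X ⟶ M), Mono i → P X → IsZero X

/-- `M` is `P`-injective: every morphism `f : X' ⟶ M` extends along every monomorphism
`i : X' ⟶ X` with `X/X'` in `P`. -/
def IsInjectiveObject (P : ObjectProperty A) (M : A) : Prop :=
  ∀ (X' X : A) (i : X' ⟶ X), Mono i → P (cokernel i) →
    ∀ f : X' ⟶ M, ∃ g : X ⟶ M, i ≫ g = f

/-- `M` is `P`-closed: it is `P`-torsion free and `P`-injective. -/
def IsClosedObject (P : ObjectProperty A) (M : A) : Prop :=
  IsTorsionFreeObject P M ∧ IsInjectiveObject P M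

end Localizing

section Closed

variable {A : Type u₁} [Category.{v₁} A] [Abelian A] {P : ObjectProperty A} [P.IsSerreClass]

/-! Modulo `classD`, `G` and `F'` are the same functor: the transpose `comparison : G ⟶ F'` of `η`
has kernel and cokernel in `classD` (`isoModSerre_comparison_app`). One side is right exact and
preserves direct sums, the other is left exact; together they carry the localizing closure of
`classC` into that of `classD` and preserve isomorphisms modulo these classes
(`isoModSerre_rightAdjoint_map`, `isoModSerre_G_map`). Hence `F'` descends to the quotients, and
`G'` does by symmetry. Transposing once more gives `𝟭 A ⟶ G' ∘ F'`, again with kernel and cokernel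
in `classC`, so the induced functors are mutually inverse. -/

lemma IsTorsionFreeObject.eq_zero_of_prop {M X : A} (hM : IsTorsionFreeObject P M) (hX : P X)
    (f : X ⟶ M) : f = 0 := by
  have h := hM _ (Abelian.image.ι f) inferInstance (P.prop_of_epi (Abelian.factorThruImage f) hX)
  rw [← Abelian.image.fac f, h.eq_zero_of_src (Abelian.image.ι f), comp_zero]

/-- Torsion freeness makes `f` vanish on `kernel s`, so `f` factors through the coimage, a subobject
of `Y` whose quotient lies in `P`. -/
lemma IsClosedObject.exists_extension {M X Y : A} (hM : IsClosedObject P M) {s : X ⟶ Y}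
    (hs : P.isoModSerre s) (f : X ⟶ M) : ∃ g : Y ⟶ M, s ≫ g = f := by
  have hk : kernel.ι s ≫ f = 0 := hM.1.eq_zero_of_prop hs.1 _
  obtain ⟨g, hg⟩ := hM.2 _ _ (Abelian.factorThruCoimage s) inferInstance
    (P.prop_of_epi (cokernel.map s (Abelian.factorThruCoimage s) (Abelian.coimage.π s) (𝟙 _)
      (by simp)) hs.2) (cokernel.desc _ f hk)
  refine ⟨g, ?_⟩
  rw [← Abelian.coimage.fac s, Category.assoc, hg]
  exact cokernel.π_desc _ _ _

end Closed

namespace RightWideMoritaContext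

variable {A : Type u₁} [Category.{v₁} A] [Abelian A]
  {B : Type u₂} [Category.{v₂} B] [Abelian B]

attribute [instance] additive_F additive_G rightExact_F rightExact_G

/-- The right wide Morita context obtained by exchanging the roles of the two categories. -/
@[simps]
def symm (Γ : RightWideMoritaContext A B) : RightWideMoritaContext B A where
  F := Γ.G
  G := Γ.F
  additive_F := Γ.additive_G
  additive_G := Γ.additive_F
  rightExact_F := Γ.rightExact_G
  rightExact_G := Γ.rightExact_F
  η := Γ.ρ
  ρ := Γ.η
  map_η := Γ.map_ρ
  map_ρ := Γ.map_η

variable (Γ : RightWideMoritaContext A B)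

lemma classC_iff (X : A) : Γ.classC X ↔ Γ.η.app X = 0 := by
  refine ⟨fun h => by simpa using h X (𝟙 X), fun h M f => ?_⟩
  have := Γ.η.naturality f
  rwa [h, comp_zero, eq_comm] at this

lemma classD_iff (Y : B) : Γ.classD Y ↔ Γ.ρ.app Y = 0 :=
  Γ.symm.classC_iff Y

lemma classD_obj {X : A} (hX : Γ.classC X) : Γ.classD (Γ.G.obj X) := by
  rw [classC_iff] at hX
  rw [classD_iff, ← Γ.map_η, hX, Functor.map_zero]

/-! ### Comparing `G` with `F'` -/

variable {F' : A ⥤ B} (adjF : Γ.F ⊣ F')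

/-- The natural transformation `G ⟶ F'` adjoint to `η`. -/
def comparison : Γ.G ⟶ F' where
  app X := adjF.homEquiv _ _ (Γ.η.app X)
  naturality X Y f := by
    rw [← adjF.homEquiv_naturality_left, ← adjF.homEquiv_naturality_right]
    exact congrArg _ (Γ.η.naturality f)

lemma comparison_app (X : A) :
    (Γ.comparison adjF).app X = adjF.homEquiv _ _ (Γ.η.app X) := rfl

lemma comp_comparison_app_eq_zero_iff {X : A} {Y : B} (k : Y ⟶ Γ.G.obj X) :
    k ≫ (Γ.comparison adjF).app X = 0 ↔ Γ.F.map k ≫ Γ.η.app X = 0 := by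
  rw [comparison_app, ← adjF.homEquiv_naturality_left, adjF.homEquiv_unit]
  constructor
  · intro h
    rw [← adjF.homEquiv_unit] at h
    apply (adjF.homEquiv _ _).injective
    have := adjF.right_adjoint_additive
    rw [h, adjF.homEquiv_unit, F'.map_zero, comp_zero]
  · intro h
    have := adjF.right_adjoint_additive
    rw [h, F'.map_zero, comp_zero]

/-- After transposing, `Fρ = ηF` reduces this to naturality of `η` at the counit. It is what
controls the cokernel of `comparison`. -/
lemma ρ_app_rightAdjoint_obj (X : A) :
    Γ.ρ.app (F'.obj X) = Γ.G.map (adjF.counit.app X) ≫ (Γ.comparison adjF).app X := by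
  apply (adjF.homEquiv _ _).symm.injective
  rw [comparison_app, adjF.homEquiv_naturality_left_symm]
  erw [Equiv.symm_apply_apply]
  rw [adjF.homEquiv_counit]
  simp only [Γ.map_ρ]
  exact (Γ.η.naturality _).symm

lemma classD_of_comp_comparison_app_eq_zero {X : A} {K : B} (k : K ⟶ Γ.G.obj X)
    (hk : k ≫ (Γ.comparison adjF).app X = 0) [Mono k] : Γ.classD K := by
  rw [comp_comparison_app_eq_zero_iff] at hk
  rw [classD_iff, ← cancel_mono k, zero_comp]
  calc Γ.ρ.app K ≫ k = Γ.G.map (Γ.F.map k) ≫ Γ.ρ.app (Γ.G.obj X) := (Γ.ρ.naturality k).symm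
    _ = 0 := by rw [← Γ.map_η, ← Functor.map_comp, hk, Functor.map_zero]

lemma classD_of_comparison_app_comp_eq_zero {X : A} {C : B} (p : F'.obj X ⟶ C)
    (hp : (Γ.comparison adjF).app X ≫ p = 0) [Epi p] : Γ.classD C := by
  -- Right exactness of `F` and `G` keeps `p` an epimorphism.
  rw [classD_iff, ← cancel_epi (Γ.G.map (Γ.F.map p)), comp_zero]
  calc Γ.G.map (Γ.F.map p) ≫ Γ.ρ.app C = Γ.ρ.app (F'.obj X) ≫ p := Γ.ρ.naturality p
    _ = 0 := by rw [ρ_app_rightAdjoint_obj, Category.assoc, hp, comp_zero]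

lemma isoModSerre_comparison_app (X : A) :
    (localizingClosure.{w} Γ.classD).isoModSerre ((Γ.comparison adjF).app X) :=
  ⟨le_localizingClosure _ _ (Γ.classD_of_comp_comparison_app_eq_zero adjF _ (kernel.condition _)),
    le_localizingClosure _ _
      (Γ.classD_of_comparison_app_comp_eq_zero adjF _ (cokernel.condition _))⟩

include adjF in
lemma localizingClosure_obj_iff (X : A) :
    localizingClosure.{w} Γ.classD (F'.obj X) ↔ localizingClosure.{w} Γ.classD (Γ.G.obj X) := by
  have h := Γ.isoModSerre_comparison_app.{w} adjF X
  have hS := ShortComplex.kernelSequence_exact ((Γ.comparison adjF).app X)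
  have hS' := ShortComplex.cokernelSequence_exact ((Γ.comparison adjF).app X)
  exact ⟨fun hX => (localizingClosure.{w} Γ.classD).prop_X₂_of_exact hS h.1 hX,
    fun hX => (localizingClosure.{w} Γ.classD).prop_X₂_of_exact hS' hX h.2⟩

include adjF in
-- Membership can be tested on `G` or on `F'`: left exactness of `F'` handles subobjects, right
-- exactness of `G` handles quotients and extensions.
lemma isSerreClass_inverseImage :
    ((localizingClosure.{w} Γ.classD).inverseImage Γ.G).IsSerreClass where
  exists_zero :=
    open ZeroObject in
    ⟨0, isZero_zero A, (localizingClosure.{w} Γ.classD).prop_of_isZero (Γ.G.map_isZero (isZero_zero A))⟩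
  prop_of_mono {X Y} f _ hY := by
    have := adjF.rightAdjoint_preservesLimits
    refine (Γ.localizingClosure_obj_iff adjF X).1 ?_
    exact (localizingClosure.{w} Γ.classD).prop_of_mono (F'.map f) ((Γ.localizingClosure_obj_iff adjF Y).2 hY)
  prop_of_epi f _ hX :=
    (localizingClosure.{w} Γ.classD).prop_of_epi (Γ.G.map f) hX
  prop_X₂_of_shortExact {S} hS h₁ h₃ := by
    have := hS.epi_g
    have hS' : (S.map Γ.G).Exact :=
      ((Γ.G.preservesFiniteColimits_tfae.out 3 1 :).1 inferInstance S ⟨hS.1, hS.3⟩).1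
    exact (localizingClosure.{w} Γ.classD).prop_X₂_of_exact hS' h₁ h₃

/-! ### Preservation of isomorphisms modulo the localizing classes -/

variable {G' : B ⥤ A} (adjG : Γ.G ⊣ G')

include adjF adjG in
lemma localizingClosure_G_obj {X : A} (hX : localizingClosure.{w} Γ.classC X) :
    localizingClosure.{w} Γ.classD (Γ.G.obj X) := by
  have := adjG.leftAdjoint_preservesColimits
  refine localizingClosure_le _ ((localizingClosure.{w} Γ.classD).inverseImage Γ.G)
    { toIsSerreClass := Γ.isSerreClass_inverseImage adjF
      closedUnderDirectSums := fun J => ⟨?_⟩ } (fun Y hY => le_localizingClosure _ _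
        (Γ.classD_obj hY)) X hX
  rintro Y ⟨p⟩
  have := (isLocalizingSubcategory_localizingClosure.{w} Γ.classD).closedUnderDirectSums J
  exact ObjectProperty.prop_of_isColimit _ (p.toColimitPresentation.map Γ.G).isColimit
    p.prop_diag_obj

include adjF adjG in
lemma epiModSerre_G_map {X Y : A} (f : X ⟶ Y)
    (hf : (localizingClosure.{w} Γ.classC).isoModSerre f) :
    (localizingClosure.{w} Γ.classD).epiModSerre (Γ.G.map f) :=
  (localizingClosure.{w} Γ.classD).prop_of_iso (PreservesCokernel.iso Γ.G f)
    (Γ.localizingClosure_G_obj adjF adjG hf.2)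

include adjF adjG in
lemma monoModSerre_rightAdjoint_map {X Y : A} (f : X ⟶ Y)
    (hf : (localizingClosure.{w} Γ.classC).isoModSerre f) :
    (localizingClosure.{w} Γ.classD).monoModSerre (F'.map f) := by
  have := adjF.right_adjoint_additive
  have := adjF.rightAdjoint_preservesLimits
  exact (localizingClosure.{w} Γ.classD).prop_of_iso (PreservesKernel.iso F' f)
    ((Γ.localizingClosure_obj_iff adjF _).2 (Γ.localizingClosure_G_obj adjF adjG hf.1))

include adjF adjG in
-- The kernel is controlled by left exactness of `F'`; the cokernel is controlled by right exactness
-- of `G`, transferred through the naturality square of `comparison`.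
lemma isoModSerre_rightAdjoint_map {X Y : A} (f : X ⟶ Y)
    (hf : (localizingClosure.{w} Γ.classC).isoModSerre f) :
    (localizingClosure.{w} Γ.classD).isoModSerre (F'.map f) := by
  refine ⟨Γ.monoModSerre_rightAdjoint_map adjF adjG f hf, ?_⟩
  have h : (localizingClosure.{w} Γ.classD).epiModSerre
      ((Γ.comparison adjF).app X ≫ F'.map f) := by
    rw [← (Γ.comparison adjF).naturality]
    exact MorphismProperty.comp_mem _ _ _ (Γ.epiModSerre_G_map adjF adjG f hf)
      (Γ.isoModSerre_comparison_app adjF Y).2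
  exact (localizingClosure.{w} Γ.classD).prop_of_epi
    (cokernel.map ((Γ.comparison adjF).app X ≫ F'.map f) (F'.map f)
      ((Γ.comparison adjF).app X) (𝟙 _) (by simp)) h

include adjF adjG in
lemma isoModSerre_G_map {X Y : A} (f : X ⟶ Y)
    (hf : (localizingClosure.{w} Γ.classC).isoModSerre f) :
    (localizingClosure.{w} Γ.classD).isoModSerre (Γ.G.map f) := by
  refine MorphismProperty.of_postcomp _ _ ((Γ.comparison adjF).app Y)
    (Γ.isoModSerre_comparison_app adjF Y) ?_
  rw [(Γ.comparison adjF).naturality]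
  exact MorphismProperty.comp_mem _ _ _ (Γ.isoModSerre_comparison_app adjF X)
    (Γ.isoModSerre_rightAdjoint_map adjF adjG f hf)

/-! ### The composite `G' ∘ F'` and the quotient categories -/

/-- The natural transformation `𝟭 A ⟶ G' ∘ F'` conjugate to `η`. -/
def unit : 𝟭 A ⟶ F' ⋙ G' :=
  adjG.unit ≫ Functor.whiskerRight (Γ.comparison adjF) G'

lemma unit_app (X : A) :
    (Γ.unit adjF adjG).app X = adjG.homEquiv _ _ ((Γ.comparison adjF).app X) := by
  simp [unit, adjG.homEquiv_unit]

lemma classC_of_comp_unit_app_eq_zero {X K : A} (k : K ⟶ X)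
    (hk : k ≫ (Γ.unit adjF adjG).app X = 0) [Mono k] : Γ.classC K := by
  have h : Γ.G.map k ≫ (Γ.comparison adjF).app X = 0 := by
    apply (adjG.homEquiv _ _).injective
    have := adjG.right_adjoint_additive
    rw [adjG.homEquiv_naturality_left, ← unit_app, hk, adjG.homEquiv_unit, G'.map_zero, comp_zero]
  rw [comp_comparison_app_eq_zero_iff] at h
  rw [classC_iff, ← cancel_mono k, zero_comp, ← h]
  exact (Γ.η.naturality k).symm

lemma η_app_rightAdjoint_obj (X : A) :
    Γ.η.app (G'.obj (F'.obj X)) =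
      Γ.F.map (adjG.counit.app (F'.obj X)) ≫ adjF.counit.app X ≫ (Γ.unit adjF adjG).app X := by
  rw [← Category.assoc]
  apply (adjG.homEquiv _ _).symm.injective
  rw [unit_app, adjG.homEquiv_naturality_left_symm]
  erw [Equiv.symm_apply_apply]
  rw [adjG.homEquiv_counit, Functor.map_comp, Category.assoc, ← ρ_app_rightAdjoint_obj]
  simp only [Γ.map_η]
  exact (Γ.ρ.naturality _).symm

lemma classC_of_unit_app_comp_eq_zero {X C : A} (p : G'.obj (F'.obj X) ⟶ C)
    (hp : (Γ.unit adjF adjG).app X ≫ p = 0) [Epi p] : Γ.classC C := by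
  rw [classC_iff, ← cancel_epi (Γ.F.map (Γ.G.map p)), comp_zero]
  calc Γ.F.map (Γ.G.map p) ≫ Γ.η.app C = Γ.η.app (G'.obj (F'.obj X)) ≫ p := Γ.η.naturality p
    _ = 0 := by
      rw [η_app_rightAdjoint_obj, Category.assoc, Category.assoc, hp, comp_zero, comp_zero]

lemma isoModSerre_unit_app (X : A) :
    (localizingClosure.{w} Γ.classC).isoModSerre ((Γ.unit adjF adjG).app X) :=
  ⟨le_localizingClosure _ _ (Γ.classC_of_comp_unit_app_eq_zero adjF adjG _ (kernel.condition _)),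
    le_localizingClosure _ _
      (Γ.classC_of_unit_app_comp_eq_zero adjF adjG _ (cokernel.condition _))⟩

/-- The composite `G' ∘ F'` becomes isomorphic to the identity in the quotient category. -/
noncomputable def unitIso :
    quotientFunctor (localizingClosure.{w} Γ.classC) ≅
      F' ⋙ G' ⋙ quotientFunctor (localizingClosure.{w} Γ.classC) :=
  NatIso.ofComponents
    (fun X => Localization.isoOfHom _ _ _ (Γ.isoModSerre_unit_app.{w} adjF adjG X))
    (fun f => by
      simp only [Localization.isoOfHom_hom, Functor.comp_map, ← Functor.map_comp]
      exact congrArg _ ((Γ.unit adjF adjG).naturality f))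

include adjF adjG in
lemma isInvertedBy_rightAdjoint_comp_quotientFunctor :
    (localizingClosure.{w} Γ.classC).isoModSerre.IsInvertedBy
      (F' ⋙ quotientFunctor (localizingClosure.{w} Γ.classD)) :=
  fun _ _ f hf => Localization.inverts (quotientFunctor _) _ _
    (Γ.isoModSerre_rightAdjoint_map adjF adjG f hf)

include adjF adjG in
lemma isClosedObject_rightAdjoint_obj {M : A}
    (hM : IsClosedObject (localizingClosure.{w} Γ.classC) M) :
    IsClosedObject (localizingClosure.{w} Γ.classD) (F'.obj M) := by
  have := adjF.right_adjoint_additive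
  refine ⟨fun X i _ hX => ?_, fun X' X i _ hi f => ?_⟩
  · have h : (adjF.homEquiv _ _).symm i = 0 :=
      hM.1.eq_zero_of_prop (Γ.symm.localizingClosure_G_obj adjG adjF hX) _
    rw [IsZero.iff_id_eq_zero, ← cancel_mono i, zero_comp, Category.id_comp]
    rw [← (adjF.homEquiv _ _).apply_symm_apply i, h, adjF.homEquiv_unit, F'.map_zero, comp_zero]
  -- `F` need not keep `i` monic, but `F.map i` is still an isomorphism modulo the class, which is
  -- enough to extend the transpose of `f`.
  · obtain ⟨g, hg⟩ := hM.exists_extension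
      (Γ.symm.isoModSerre_G_map adjG adjF i (ObjectProperty.isoModSerre_of_mono _ i hi))
      ((adjF.homEquiv _ _).symm f)
    exact ⟨adjF.homEquiv _ _ g, (adjF.homEquiv_naturality_left i g).symm.trans
      ((adjF.homEquiv _ _).symm_apply_eq.1 hg.symm).symm⟩

end RightWideMoritaContext

theorem mainTheorem1
    {A : Type u₁} [Category.{v₁} A] [Abelian A] [IsGrothendieckAbelian.{w} A]
    {B : Type u₂} [Category.{v₂} B] [Abelian B] [IsGrothendieckAbelian.{w} B]
    (Γ : RightWideMoritaContext A B)
    (F' : A ⥤ B) (G' : B ⥤ A) (adjF : Γ.F ⊣ F') (adjG : Γ.G ⊣ G') :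
    -- `F'` and `G'` restrict to functors between the subcategories of closed objects
    (∀ M : A, IsClosedObject (localizingClosure.{w} Γ.classC) M →
      IsClosedObject (localizingClosure.{w} Γ.classD) (F'.obj M)) ∧
    (∀ N : B, IsClosedObject (localizingClosure.{w} Γ.classD) N →
      IsClosedObject (localizingClosure.{w} Γ.classC) (G'.obj N)) ∧
    -- `F'` and `G'` induce mutually inverse equivalences between the quotient categories
    ∃ e : QuotientCategory (localizingClosure.{w} Γ.classC) ≌
        QuotientCategory (localizingClosure.{w} Γ.classD),
      Nonempty (quotientFunctor (localizingClosure.{w} Γ.classC) ⋙ e.functor ≅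
        F' ⋙ quotientFunctor (localizingClosure.{w} Γ.classD)) ∧
      Nonempty (quotientFunctor (localizingClosure.{w} Γ.classD) ⋙ e.inverse ≅
        G' ⋙ quotientFunctor (localizingClosure.{w} Γ.classC)) := by
  refine ⟨fun M hM => Γ.isClosedObject_rightAdjoint_obj adjF adjG hM,
    fun N hN => Γ.symm.isClosedObject_rightAdjoint_obj adjG adjF hN, ?_⟩
  have hF' := Γ.isInvertedBy_rightAdjoint_comp_quotientFunctor.{w} adjF adjG
  have hG' : (localizingClosure.{w} Γ.classD).isoModSerre.IsInvertedBy
      (G' ⋙ quotientFunctor (localizingClosure.{w} Γ.classC)) :=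
    Γ.symm.isInvertedBy_rightAdjoint_comp_quotientFunctor.{w} adjG adjF
  let QC := quotientFunctor (localizingClosure.{w} Γ.classC)
  let QD := quotientFunctor (localizingClosure.{w} Γ.classD)
  let E := Localization.lift (F' ⋙ QD) hF' QC
  let E' := Localization.lift (G' ⋙ QC) hG' QD
  let ε : QD ≅ G' ⋙ F' ⋙ QD := Γ.symm.unitIso.{w} adjG adjF
  -- Isomorphisms between functors out of a localization may be given after precomposing with the
  -- quotient functor, so `unitIso` for `Γ` and for `Γ.symm` suffices.
  exact ⟨Localization.equivalence QC (localizingClosure.{w} Γ.classC).isoModSerre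
      QD (localizingClosure.{w} Γ.classD).isoModSerre (F' ⋙ QD) E (G' ⋙ QC) E'
      (Functor.isoWhiskerLeft F' (Localization.fac (G' ⋙ QC) hG' QD) ≪≫
        (Γ.unitIso adjF adjG).symm)
      (Functor.isoWhiskerLeft G' (Localization.fac (F' ⋙ QD) hF' QC) ≪≫ ε.symm),
    ⟨Localization.fac (F' ⋙ QD) hF' QC⟩, ⟨Localization.fac (G' ⋙ QC) hG' QD⟩⟩
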